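/- Let $\mathbb F_q$ be a finite field and let $G$ be a finite acyclic ADT network over $\mathbb F_q$: a set of supernodes $V$, each with a finite set $I(V)$ of input ports and a finite set $O(V)$ of output ports, and a set $\mathcal E$ of edges $(e,e')$ from output ports to input ports, such that the directed graph induced on the supernodes has no directed cycle. Let $S$ be a supernode (the source) with processes $\mathcal X(S)=\{X(S,1),\dots,X(S,\mu)\}$. For a field $\mathbb K\supseteq\mathbb F_q$, a linear code over $\mathbb K$ consists of coefficients $\alpha_{(i,e)},\beta_{(e',e)},\varepsilon_{(e',(T,i))}\in \mathbb K$. For source symbols $X(S,i)\in \mathbb K$, it determines the symbols at the ports by $$Y(e)=\sum_{e'\in I(V)}\beta_{(e',e)}Y(e')\;\Bigl(+\sum_i\alpha_{(i,e)}X(S,i)\text{ if }V=S\Bigr)\quad(e\in O(V)),\qquad Y(e')=\sum_{(e,e')\in\mathcal E}Y(e)\quad(e'\text{ an input port}),$$ and the processes formed at a supernode $T$ by $Z(T,i)=\sum_{e'\in I(T)}\varepsilon_{(e',(T,i))}Y(e')$. A connection $(S,T,\mathcal X(S,T))$ with $\mathcal X(S,T)\subseteq\mathcal X(S)$ is established if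 $Z(T,i)=X(S,i)$ for every $X(S,i)\in\mathcal X(S,T)$ and all values of the source symbols. For a set $\mathcal C$ of connections, $(G,\mathcal C)$ is solvable over $\mathbb K$ if one linear code over $\mathbb K$ establishes all connections in $\mathcal C$, and solvable if it is solvable over some finite extension field $\mathbb K$ of $\mathbb F_q$. For a set $\mathcal T'$ of supernodes with $S\notin\mathcal T'$ let $\mathrm{mincut}(S,\mathcal T')=\min_\Omega \mathrm{rank}(G_\Omega)$, where $\Omega$ runs over the sets of supernodes with $S\in\Omega$ and $\Omega\cap\mathcal T'=\emptyset$, and $G_\Omega$ is the $0$-$1$ incidence matrix, over $\mathbb F_q$, of the edges from the output ports in $\Omega$ to the input ports outside $\Omega$. **Theorem (Two-level multicast).** Let $0\le K\le N$, let $T_1,\dots,T_N$ be supernodes different from $S$, let $\mathcal X(S,T_1),\dots,\mathcal X(S,T_K)\subseteq\mathcal X(S)$ be pairwise disjoint, and let $$\mathcal C=\{(S,T_i,\mathcal X(S,T_i)) : 1\le i\le K\}\cup\{(S,T_j,\mathcal X(S)) : K<j\le N\}.$$ Then $(G,\mathcal C)$ is solvable if and only if $$\mathrm{mincut}(S,\{T_i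 : i\in J\})\ \ge\ \sum_{i\in J}|\mathcal X(S,T_i)|\quad\text{for all } J\subseteq\{1,\dots,K\},\qquad\text{and}\qquad \mathrm{mincut}(S,T_j)\ge|\mathcal X(S)|\quad\text{for all } K<j\le N.$$ Moreover, if $q>N$, then $(G,\mathcal C)$ is solvable over $\mathbb F_q$ itself if and only if these conditions hold. -/

import Mathlib

universe u

/-- A (deterministic, ADT) wireless network: supernodes `V`, input ports `I`, output ports `O`;
every port belongs to a supernode, and edges run from output ports to input ports.
An output port with several edges is a broadcast, an input port with several edges is an
additive multiple access channel. -/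
structure ADTNetwork (V I O : Type*) where
  /-- the supernode owning an input port -/
  inNode : I → V
  /-- the supernode owning an output port -/
  outNode : O → V
  /-- `edge e e'`: there is an edge from the output port `e` to the input port `e'` -/
  edge : O → I → Prop

/-- A connection from the (fixed) source: the destination `dest` is to replicate
the source processes `X(S, i)` with `i ∈ demand`. -/
structure Connection (V : Type*) (μ : ℕ) where
  /-- the destination supernode -/
  dest : V
  /-- the indices of the requested source processes -/
  demand : Finset (Fin μ)

/-- A linear network code over `K` for a source with `μ` processes: the coefficients `α` at the
source, `β` at the supernodes, and `ε` at the destinations (`ε t i` are the coefficients used by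
the supernode `t` to form its replica of the `i`-th source process). Coefficients attached to
ports of different supernodes are never used. -/
structure LinearCode (V I O : Type*) (μ : ℕ) (K : Type*) where
  /-- source coefficients -/
  α : Fin μ → O → K
  /-- coefficients from an input port to an output port of the same supernode -/
  β : I → O → K
  /-- decoding coefficients -/
  ε : V → Fin μ → I → K

namespace ADTNetwork

variable {V I O : Type*}

/-- There is an edge from an output port of `v` to an input port of `w`. -/
def Adj (G : ADTNetwork V I O) (v w : V) : Prop :=
  ∃ e e', G.outNode e = v ∧ G.inNode e' = w ∧ G.edge e e'

/-- There is no directed cycle of supernodes. -/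
def Acyclic (G : ADTNetwork V I O) : Prop :=
  ∀ v, ¬ Relation.TransGen G.Adj v v

open Classical in
/-- The matrix `G_Ω` of a cut: the 0-1 incidence matrix between the output ports in `Ω` and the
input ports outside of `Ω`. -/
noncomputable def cutMatrix (G : ADTNetwork V I O) (F : Type*) [Field F] (Ω : Finset V) :
    Matrix {e : O // G.outNode e ∈ Ω} {e' : I // G.inNode e' ∉ Ω} F :=
  Matrix.of fun e e' => if G.edge e e' then 1 else 0

/-- `mincut(S, D)` for a source `S` and a set `D` of destinations: the minimum of `rank G_Ω` over
all sets `Ω` of supernodes that contain `S` and no element of `D`. (Such `Ω` exist when `S ∉ D`.) -/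
noncomputable def mincut [DecidableEq V] [Fintype I] (G : ADTNetwork V I O)
    (F : Type*) [Field F] (S : V) (D : Finset V) : ℕ :=
  sInf {r | ∃ Ω : Finset V, S ∈ Ω ∧ Disjoint D Ω ∧ r = (G.cutMatrix F Ω).rank}

open Classical in
/-- `yIn`, `yOut` are the symbols at the ports when the source symbols are `x` and the code `c` is
used: an output port carries a linear combination of the symbols at the input ports of its supernode
(plus a linear combination of the source symbols if that supernode is the source),
an input port receives the sum of the symbols of the output ports connected to it. -/
def IsTransmission [Fintype I] [Fintype O] (G : ADTNetwork V I O) {K : Type*} [Field K] {μ : ℕ}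
    (S : V) (c : LinearCode V I O μ K) (x : Fin μ → K) (yIn : I → K) (yOut : O → K) : Prop :=
  (∀ e, yOut e = (∑ e' with G.inNode e' = G.outNode e, c.β e' e * yIn e') +
      if G.outNode e = S then ∑ i, c.α i e * x i else 0) ∧
  (∀ e', yIn e' = ∑ e with G.edge e e', yOut e)

open Classical in
/-- The process `Z(t, i)` formed by the supernode `t` from the symbols at its input ports. -/
noncomputable def output [Fintype I] (G : ADTNetwork V I O) {K : Type*} [Field K] {μ : ℕ}
    (c : LinearCode V I O μ K) (yIn : I → K) (t : V) (i : Fin μ) : K :=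
  ∑ e' with G.inNode e' = t, c.ε t i e' * yIn e'

/-- The connections `C` from `S` can be established with coefficients in `K`: for some linear code
every destination replicates its requested processes, whatever the source symbols are.
(In an acyclic network the symbols at the ports are determined by the code and the source
symbols.) -/
def SolvableOver [Fintype I] [Fintype O] (G : ADTNetwork V I O) (K : Type*) [Field K] {μ : ℕ}
    (S : V) (C : Set (Connection V μ)) : Prop :=
  ∃ c : LinearCode V I O μ K, ∀ x : Fin μ → K, ∃ (yIn : I → K) (yOut : O → K),
    G.IsTransmission S c x yIn yOut ∧
      ∀ d ∈ C, ∀ i ∈ d.demand, G.output c yIn d.dest i = x i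

/-- `(G, C)` is solvable, for a network over the finite field `F`: the connections can be
established with symbols and coefficients in some finite extension field of `F`. -/
def Solvable [Fintype I] [Fintype O] (G : ADTNetwork V I O) (F : Type u) [Field F] {μ : ℕ}
    (S : V) (C : Set (Connection V μ)) : Prop :=
  ∃ (K : Type u) (_ : Field K) (_ : Finite K) (_ : Algebra F K), G.SolvableOver K S C

end ADTNetwork

/-- The connection set in which `T k` requests `X k` for every `k`, and every `T' l` requests all
source processes. -/
def twoLevelConnections {V : Type*} {μ K L : ℕ} (T : Fin K → V) (X : Fin K → Finset (Fin μ))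
    (T' : Fin L → V) : Set (Connection V μ) :=
  (Set.range fun k => ⟨T k, X k⟩) ∪ (Set.range fun l => ⟨T' l, Finset.univ⟩)

/-- The cut conditions of a two-level multicast. -/
def TwoLevelCutConditions {V I O : Type*} [DecidableEq V] [Fintype I] (G : ADTNetwork V I O)
    (F : Type*) [Field F] (S : V) {μ K L : ℕ} (T : Fin K → V) (X : Fin K → Finset (Fin μ))
    (T' : Fin L → V) : Prop :=
  (∀ J : Finset (Fin K), ∑ k ∈ J, (X k).card ≤ G.mincut F S (J.image T)) ∧
    ∀ l, μ ≤ G.mincut F S {T' l}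

/-!
In an acyclic network the symbols at the input ports are the source symbols multiplied by a matrix,
the encoding, that changes by a matrix of rank at most one when one coefficient of the code
changes. The response of the ports beyond a cut `Ω` to symbols injected in `Ω` has the rank of
`G_Ω`, whatever the coefficients. This bounds the rank of the encoding beyond the cut, so the cut
conditions are necessary.

Over an infinite field some coefficients are generic: they maximize the rank of the encoding at
every set of input ports at once. If the symbols received in `D` span a proper subspace `U`, let
`Ω` consist of the source and the supernodes receiving a symbol outside `U`. Changing a coefficient
in `Ω` cannot increase the rank beyond `Ω`, and this forces that rank to be the rank of `G_Ω`. So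
generic coefficients attain all min-cuts simultaneously. The cut conditions then are the
hypothesis of Rado's theorem for the spaces received at the `T k`, which yields linearly
independent symbols, one for each request; a linear automorphism applied at the source turns these
into the requested processes.

To descend to a small field, note that a condition `r ≤ rank`, once satisfied, fails for at most
one value of each single parameter. Hence finitely many such conditions, each satisfiable over some
extension, are satisfiable together with parameters from any set with more elements than there are
conditions. All requests at the `T k` form a single condition, and each `T' l` contributes one.
-/

section RankOne
open Matrix Module

/-- `M` depends on the parameters `p : X → K` in such a way that a change of one parameter changes
the matrix by a scalar multiple of a fixed matrix of rank at most one. -/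
def IsRankOneAffine {X K m n : Type*} [DecidableEq X] [Ring K] (M : (X → K) → Matrix m n K) :
    Prop :=
  ∀ p v, ∃ h q, ∀ a, M (Function.update p v a) = M p + (a - p v) • vecMulVec h q

theorem isNilpotent_of_forall_ne_zero_lt {ι R : Type*} [Fintype ι] [DecidableEq ι] [Semiring R]
    {A : Matrix ι ι R} (f : ι → ℕ) (hA : ∀ i j, A i j ≠ 0 → f j < f i) : IsNilpotent A := by
  have hpow : ∀ n i j, (A ^ n) i j ≠ 0 → f j + n ≤ f i := by
    intro n
    induction n with
    | zero =>
      intro i j h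
      have : i = j := by by_contra hij; exact h (by simp [hij])
      simp [this]
    | succ n ih =>
      intro i j h
      rw [pow_succ', mul_apply] at h
      obtain ⟨k, -, hk⟩ := Finset.exists_ne_zero_of_sum_ne_zero h
      have h₁ := hA i k (left_ne_zero_of_mul hk)
      have h₂ := ih k j (right_ne_zero_of_mul hk)
      omega
  refine ⟨Finset.univ.sup f + 1, ?_⟩
  ext i j
  by_contra h
  have h₁ := hpow _ i j h
  have h₂ : f i ≤ Finset.univ.sup f := Finset.le_sup (Finset.mem_univ i)
  omega

variable {K m n : Type*} [Field K] [Finite m] [Fintype n]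

theorem col_add_vecMulVec {R m n : Type*} [CommSemiring R] (A : Matrix m n R) (h : m → R)
    (q : n → R) (j : n) : (A + vecMulVec h q).col j = A.col j + q j • h := by
  ext i
  simp [vecMulVec_apply, mul_comm]

theorem rank_add_vecMulVec_le_of_mem_span_col (A : Matrix m n K) {h : m → K}
    (hh : h ∈ Submodule.span K (Set.range A.col)) (q : n → K) :
    (A + vecMulVec h q).rank ≤ A.rank := by
  rw [rank_eq_finrank_span_cols, rank_eq_finrank_span_cols]
  refine Submodule.finrank_mono (Submodule.span_le.2 ?_)
  rintro _ ⟨j, rfl⟩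
  rw [col_add_vecMulVec]
  exact add_mem (Submodule.subset_span ⟨j, rfl⟩) (Submodule.smul_mem _ _ hh)

theorem rank_add_vecMulVec_le_of_mem_span_row (A : Matrix m n K) (h : m → K) {q : n → K}
    (hq : q ∈ Submodule.span K (Set.range A.row)) : (A + vecMulVec h q).rank ≤ A.rank := by
  have := Fintype.ofFinite m
  have := rank_add_vecMulVec_le_of_mem_span_col Aᵀ hq h
  rwa [← transpose_vecMulVec, ← transpose_add, rank_transpose, rank_transpose] at this

theorem exists_mulVec_eq_zero_dotProduct_ne_zero {m : Type*} (A : Matrix m n K) {q : n → K}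
    (hq : q ∉ Submodule.span K (Set.range A.row)) : ∃ x, A *ᵥ x = 0 ∧ q ⬝ᵥ x ≠ 0 := by
  classical
  obtain ⟨f, hfq, hf⟩ := Submodule.exists_le_ker_of_notMem hq
  obtain ⟨x, rfl⟩ := (dotProductEquiv K n).surjective f
  refine ⟨x, ?_, ?_⟩
  · ext i
    exact (dotProduct_comm _ _).trans (hf (Submodule.subset_span ⟨i, rfl⟩))
  · simpa [dotProduct_comm] using hfq

theorem rank_lt_rank_add_vecMulVec {m : Type*} (A : Matrix m n K) {h : m → K} {q : n → K}
    (hh : h ∉ Submodule.span K (Set.range A.col)) (hq : q ∉ Submodule.span K (Set.range A.row)) :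
    A.rank < (A + vecMulVec h q).rank := by
  obtain ⟨x, hAx, hqx⟩ := exists_mulVec_eq_zero_dotProduct_ne_zero A hq
  rw [← range_mulVecLin] at hh
  have hmem : h ∈ LinearMap.range (A + vecMulVec h q).mulVecLin :=
    ⟨(q ⬝ᵥ x)⁻¹ • x, by
      simp [hAx, vecMulVec_mulVec, smul_smul, hqx]⟩
  refine Submodule.finrank_lt_finrank_of_lt (lt_of_le_of_ne ?_ fun heq => hh (heq ▸ hmem))
  rintro _ ⟨z, rfl⟩
  have : A *ᵥ z = (A + vecMulVec h q) *ᵥ z - (q ⬝ᵥ z) • h := by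
    simp [add_mulVec, vecMulVec_mulVec]
  rw [mulVecLin_apply, this]
  exact sub_mem ⟨z, rfl⟩ (Submodule.smul_mem _ _ hmem)

theorem rank_add_vecMulVec_le (A : Matrix m n K) (h : m → K) (q : n → K) :
    (A + vecMulVec h q).rank ≤ A.rank + 1 := by
  rw [rank_eq_finrank_span_cols, rank_eq_finrank_span_cols]
  have hle : Submodule.span K (Set.range (A + vecMulVec h q).col) ≤
      Submodule.span K (Set.range A.col) ⊔ K ∙ h := by
    refine Submodule.span_le.2 ?_
    rintro _ ⟨j, rfl⟩
    rw [col_add_vecMulVec]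
    exact Submodule.add_mem_sup (Submodule.subset_span ⟨j, rfl⟩)
      (Submodule.smul_mem _ _ (Submodule.mem_span_singleton_self h))
  refine (Submodule.finrank_mono hle).trans
    ((Submodule.finrank_add_le_finrank_add_finrank _ _).trans ?_)
  gcongr
  exact (finrank_span_le_card {h}).trans (by simp)

theorem subsingleton_rank_add_smul_vecMulVec_lt (A : Matrix m n K) (h : m → K) (q : n → K) {r : ℕ}
    (hr : r ≤ A.rank) : {t : K | (A + t • vecMulVec h q).rank < r}.Subsingleton := by
  intro a ha b hb
  by_contra hab
  rw [Set.mem_ofPred, ← smul_vecMulVec] at ha hb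
  set g := A + vecMulVec (a • h) q with hg
  have hA : A = g + vecMulVec (-a • h) q := by simp [hg, smul_vecMulVec]
  have hB : A + vecMulVec (b • h) q = g + vecMulVec ((b - a) • h) q := by
    rw [hg, add_assoc, ← add_vecMulVec, ← add_smul, add_sub_cancel]
  rw [hB] at hb
  have hcol : (b - a) • h ∉ Submodule.span K (Set.range g.col) := fun hmem => by
    have := rank_add_vecMulVec_le_of_mem_span_col g (h := -a • h) (Submodule.smul_mem _ _
      ((Submodule.smul_mem_iff _ (sub_ne_zero.2 (Ne.symm hab))).1 hmem)) q
    rw [← hA] at this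
    omega
  have hrow : q ∉ Submodule.span K (Set.range g.row) := fun hmem => by
    have := rank_add_vecMulVec_le_of_mem_span_row g (-a • h) hmem
    rw [← hA] at this
    omega
  have h₁ := rank_lt_rank_add_vecMulVec g hcol hrow
  have h₂ : A.rank ≤ g.rank + 1 := by
    conv_lhs => rw [hA]
    exact rank_add_vecMulVec_le _ _ _
  omega

theorem IsRankOneAffine.subsingleton_rank_lt {X : Type*} [DecidableEq X]
    {M : (X → K) → Matrix m n K} (hM : IsRankOneAffine M) {p : X → K} {r : ℕ}
    (hr : r ≤ (M p).rank) (v : X) :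
    {a | (M (Function.update p v a)).rank < r}.Subsingleton := by
  obtain ⟨h, q, hMv⟩ := hM p v
  intro a ha b hb
  rw [Set.mem_ofPred, hMv] at ha hb
  exact sub_left_injective (subsingleton_rank_add_smul_vecMulVec_lt (M p) h q hr ha hb)

theorem IsRankOneAffine.submatrix {X R m n m' : Type*} [DecidableEq X] [Ring R]
    {M : (X → R) → Matrix m n R} (hM : IsRankOneAffine M) (f : m' → m) :
    IsRankOneAffine fun p => (M p).submatrix f id := by
  intro p v
  obtain ⟨h, q, hMv⟩ := hM p v
  exact ⟨h ∘ f, q, fun a => by ext; simp [hMv, vecMulVec_apply]⟩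

theorem IsRankOneAffine.comp_inl {X Y R m n : Type*} [DecidableEq X] [DecidableEq Y] [Ring R]
    {M : (X → R) → Matrix m n R} (hM : IsRankOneAffine M) :
    IsRankOneAffine fun p : X ⊕ Y → R => M (p ∘ Sum.inl) := by
  rintro p (v | v)
  · obtain ⟨h, q, hv⟩ := hM (p ∘ Sum.inl) v
    exact ⟨h, q, fun a => by simp [Sum.update_inl_comp_inl, hv]⟩
  · exact ⟨0, 0, fun a => by simp [Sum.update_inr_comp_inl]⟩

theorem IsRankOneAffine.mul {X Y R l m n : Type*} [DecidableEq X] [DecidableEq Y] [CommRing R]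
    [Fintype m] {A : (X → R) → Matrix m n R} {C : (Y → R) → Matrix l m R} (hC : IsRankOneAffine C)
    (hA : IsRankOneAffine A) :
    IsRankOneAffine fun p : X ⊕ Y → R => C (p ∘ Sum.inr) * A (p ∘ Sum.inl) := by
  rintro p (v | v)
  · obtain ⟨h, q, hv⟩ := hA (p ∘ Sum.inl) v
    exact ⟨C (p ∘ Sum.inr) *ᵥ h, q, fun a => by
      simp [Sum.update_inl_comp_inl, Sum.update_inl_comp_inr, hv, Matrix.mul_add,
        mul_vecMulVec]⟩
  · obtain ⟨h, q, hv⟩ := hC (p ∘ Sum.inr) v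
    exact ⟨h, q ᵥ* A (p ∘ Sum.inl), fun a => by
      simp [Sum.update_inr_comp_inl, Sum.update_inr_comp_inr, hv, Matrix.add_mul,
        vecMulVec_mul]⟩

theorem exists_mem_iInter_of_subsingleton_update_notMem {ι X K : Type*} [Fintype ι] [Finite X]
    [DecidableEq X] {s : Finset K} (hs : Fintype.card ι < s.card) (P : ι → Set (X → K))
    (hP : ∀ i, ∀ p ∈ P i, ∀ v, {a | Function.update p v a ∉ P i}.Subsingleton)
    (hne : ∀ i, (P i).Nonempty) : ∃ p : X → K, (∀ v, p v ∈ s) ∧ ∀ i, p ∈ P i := by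
  have := Fintype.ofFinite X
  suffices H : ∀ A : Finset X, ∃ p : X → K, (∀ v, p v ∈ s) ∧ ∀ i, ∃ p' ∈ P i, ∀ v ∈ A, p' v = p v by
    obtain ⟨p, hps, hp⟩ := H Finset.univ
    refine ⟨p, hps, fun i => ?_⟩
    obtain ⟨p', hp', hpp'⟩ := hp i
    rwa [← funext fun v => hpp' v (Finset.mem_univ v)]
  intro A
  induction A using Finset.induction_on with
  | empty =>
    obtain ⟨a, ha⟩ := Finset.card_pos.1 (Nat.zero_lt_of_lt hs)
    exact ⟨fun _ => a, fun _ => ha, fun i => by simpa using! hne i⟩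
  | insert v A hv ih =>
    obtain ⟨p, hps, hp⟩ := ih
    choose p' hp' hpp' using hp
    obtain ⟨a, ha, haP⟩ : ∃ a ∈ s, ∀ i, Function.update (p' i) v a ∈ P i := by
      by_contra! hcon
      choose f hf using fun a : s => hcon a a.2
      have hinj : Function.Injective f := fun a b hab =>
        Subtype.ext (hP (f a) _ (hp' _) v (hf a) (by rw [hab]; exact hf b))
      have := Fintype.card_le_of_injective f hinj
      rw [Fintype.card_coe] at this
      omega
    refine ⟨Function.update p v a, fun w => ?_, fun i => ⟨_, haP i, fun w hw => ?_⟩⟩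
    · obtain rfl | hw := eq_or_ne w v
      · simpa using ha
      · simpa [hw] using hps w
    · obtain rfl | hwv := eq_or_ne w v
      · simp
      · simpa [hwv] using hpp' i w (Finset.mem_of_mem_insert_of_ne hw hwv)

section Family

variable {X ι : Type*} [Finite X] [DecidableEq X] {m : ι → Type*} [∀ i, Finite (m i)]
  {M : ∀ i, (X → K) → Matrix (m i) n K}

theorem exists_forall_le_rank [Fintype ι] (hM : ∀ i, IsRankOneAffine (M i)) {r : ι → ℕ}
    (hr : ∀ i, ∃ p, r i ≤ (M i p).rank) {s : Finset K} (hs : Fintype.card ι < s.card) :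
    ∃ p : X → K, (∀ v, p v ∈ s) ∧ ∀ i, r i ≤ (M i p).rank :=
  exists_mem_iInter_of_subsingleton_update_notMem hs (fun i => {p | r i ≤ (M i p).rank})
    (fun i _ hp v => by simpa only [Set.mem_ofPred, not_le] using (hM i).subsingleton_rank_lt hp v)
    hr

theorem exists_forall_rank_le [Finite ι] [Infinite K] (hM : ∀ i, IsRankOneAffine (M i)) :
    ∃ p : X → K, ∀ i p', (M i p').rank ≤ (M i p).rank := by
  have := Fintype.ofFinite ι
  have hmax : ∀ i, ∃ p, ∀ p', (M i p').rank ≤ (M i p).rank := fun i => by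
    have hfin : (Set.range fun p => (M i p).rank).Finite :=
      (Set.finite_Iic (Fintype.card n)).subset (by rintro _ ⟨p, rfl⟩; exact rank_le_card_width _)
    obtain ⟨_, ⟨p, rfl⟩, hp⟩ := Set.exists_max_image _ id hfin (Set.range_nonempty _)
    exact ⟨p, fun p' => hp _ ⟨p', rfl⟩⟩
  choose p₀ hp₀ using hmax
  obtain ⟨s, hs⟩ := Infinite.exists_subset_card_eq K (Fintype.card ι + 1)
  obtain ⟨p, -, hp⟩ := exists_forall_le_rank hM (fun i => ⟨p₀ i, le_rfl⟩) (s := s) (by omega)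
  exact ⟨p, fun i p' => (hp₀ i p').trans (hp i)⟩

end Family

end RankOne

section Rank
open Matrix Module

theorem rank_submatrix_val_eq_finrank_span_image_row {K m n : Type*} [Field K] [Fintype n]
    (A : Matrix m n K) (s : Set m) [Finite s] :
    (A.submatrix (Subtype.val : s → m) id).rank = finrank K (Submodule.span K (A.row '' s)) := by
  rw [rank_eq_finrank_span_row, Set.image_eq_range]
  rfl

theorem exists_rank_factorization {F m n : Type*} [Field F] [Fintype m] [Fintype n]
    (A : Matrix m n F) :
    ∃ (B : Matrix m (Fin A.rank) F) (C : Matrix (Fin A.rank) n F) (B' : Matrix (Fin A.rank) m F)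
      (C' : Matrix n (Fin A.rank) F), A = B * C ∧ B' * A * C' = 1 := by
  classical
  let e : LinearMap.range A.mulVecLin ≃ₗ[F] (Fin A.rank → F) :=
    LinearEquiv.ofFinrankEq _ _ (finrank_fin_fun F).symm
  let b := (LinearMap.range A.mulVecLin).subtype ∘ₗ e.symm.toLinearMap
  let c := e.toLinearMap ∘ₗ A.mulVecLin.rangeRestrict
  obtain ⟨b', hb'⟩ := b.exists_leftInverse_of_injective
    (LinearMap.ker_eq_bot.2 ((Submodule.subtype_injective _).comp e.symm.injective))
  obtain ⟨c', hc'⟩ := c.exists_rightInverse_of_surjective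
    (LinearMap.range_eq_top.2 (e.surjective.comp A.mulVecLin.surjective_rangeRestrict))
  have hbc : b ∘ₗ c = A.mulVecLin := by ext; simp [b, c]
  refine ⟨b.toMatrix', c.toMatrix', b'.toMatrix', c'.toMatrix', ?_, ?_⟩
  · rw [← LinearMap.toMatrix'_comp, hbc]
    exact (LinearMap.toMatrix'_toLin' A).symm
  · have hid : b' ∘ₗ A.mulVecLin ∘ₗ c' = LinearMap.id := by
      rw [← hbc, LinearMap.comp_assoc, hc', LinearMap.comp_id, hb']
    rw [← LinearMap.toMatrix'_id, ← hid, LinearMap.toMatrix'_comp, LinearMap.toMatrix'_comp,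
      Matrix.mul_assoc]
    congr 2
    exact (LinearMap.toMatrix'_toLin' A).symm

theorem rank_map_ringHom {F K m n : Type*} [Field F] [Field K] [Finite m] [Fintype n] (φ : F →+* K)
    (A : Matrix m n F) : (A.map φ).rank = A.rank := by
  classical
  have := Fintype.ofFinite m
  obtain ⟨B, C, B', C', hA, hone⟩ := exists_rank_factorization A
  have hmap : A.map φ = B.map φ * C.map φ := by rw [← Matrix.map_mul, ← hA]
  refine le_antisymm ?_ ?_
  · rw [hmap]
    exact (rank_mul_le_left _ _).trans ((rank_le_card_width _).trans (Fintype.card_fin _).le)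
  · calc A.rank = (B'.map φ * A.map φ * C'.map φ).rank := by
          rw [← Matrix.map_mul, ← Matrix.map_mul, hone, Matrix.map_one _ (map_zero φ) (map_one φ),
            rank_one, Fintype.card_fin]
      _ ≤ (B'.map φ * A.map φ).rank := rank_mul_le_left _ _
      _ ≤ (A.map φ).rank := rank_mul_le_right _ _

theorem linearIndependent_row_iff_card_le_rank {m n K : Type*} [Fintype m] [Fintype n] [Field K]
    {A : Matrix m n K} : LinearIndependent K A.row ↔ Fintype.card m ≤ A.rank := by
  rw [linearIndependent_iff_card_le_finrank_span, rank_eq_finrank_span_row]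
  rfl

theorem single_mem_span_row_image_iff {K m n : Type*} [Field K] [Fintype n] [DecidableEq n]
    (A : Matrix m n K) (s : Finset m) (i : n) :
    Pi.single i 1 ∈ Submodule.span K (A.row '' s) ↔
      ∃ c : m → K, ∀ x : n → K, ∑ b ∈ s, c b * (A *ᵥ x) b = x i := by
  rw [Submodule.mem_span_image_finset_iff_exists_fun']
  refine exists_congr fun c => ?_
  have hdot : ∀ x : n → K, ∑ b ∈ s, c b * (A *ᵥ x) b = (∑ b ∈ s, c b • A.row b) ⬝ᵥ x := fun x => by
    simp only [sum_dotProduct, smul_dotProduct, smul_eq_mul]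
    rfl
  simp only [hdot]
  refine ⟨fun h x => by rw [h, single_one_dotProduct], fun h => ?_⟩
  exact dotProduct_eq _ _ fun x => (h x).trans (single_one_dotProduct i x).symm

theorem exists_linearEquiv_forall_apply_eq {ι K E : Type*} [Field K] [AddCommGroup E]
    [Module K E] [FiniteDimensional K E] {v w : ι → E} (hv : LinearIndependent K v)
    (hw : LinearIndependent K w) : ∃ g : E ≃ₗ[K] E, ∀ i, g (v i) = w i := by
  let f := hv.linearCombinationEquiv.symm ≪≫ₗ hw.linearCombinationEquiv
  obtain ⟨g, hg⟩ := Submodule.exists_linearEquiv_restrict_eq f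
  refine ⟨g, fun i => ?_⟩
  have hmem : v i ∈ Submodule.span K (Set.range v) := Submodule.subset_span ⟨i, rfl⟩
  have hsymm : hv.linearCombinationEquiv.symm ⟨v i, hmem⟩ = Finsupp.single i 1 := by
    rw [LinearEquiv.symm_apply_eq]
    ext
    simp
  rw [← hg ⟨v i, hmem⟩]
  simp [f, hsymm]

end Rank

section Rado
open Module

theorem exists_lt_lt_sup_eq {K E : Type*} [Field K] [AddCommGroup E] [Module K E]
    {W : Submodule K E} (hW : 1 < finrank K W) : ∃ A < W, ∃ B < W, A ⊔ B = W := by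
  obtain ⟨⟨v, hvW⟩, hv⟩ : ∃ v : W, v ≠ 0 := by
    have := nontrivial_of_finrank_pos (R := K) (M := W) (by omega)
    exact exists_ne 0
  have hv' : v ≠ 0 := fun h => hv (Subtype.ext h)
  have hle : K ∙ v ≤ W := (Submodule.span_singleton_le_iff_mem _ _).2 hvW
  obtain ⟨C, hC⟩ := exists_isCompl (K ∙ v)
  refine ⟨K ∙ v, lt_of_le_of_ne hle fun h => ?_, C ⊓ W, lt_of_le_of_ne inf_le_right fun h => ?_, ?_⟩
  · rw [← h, finrank_span_singleton hv'] at hW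
    exact hW.false
  · exact hv' (Submodule.disjoint_def.1 hC.disjoint v (Submodule.mem_span_singleton_self v)
      (inf_eq_right.1 h hvW))
  · rw [← sup_inf_assoc_of_le C hle, hC.sup_eq_top, top_inf_eq]

variable {ι K E : Type*} [Field K] [AddCommGroup E] [Module K E] [FiniteDimensional K E]

theorem exists_lt_forall_card_lt_finrank_sup {W : ι → Submodule K E}
    (hW : ∀ J : Finset ι, J.card ≤ finrank K (J.sup W : Submodule K E)) {i : ι}
    (hi : 1 < finrank K (W i)) :
    ∃ A < W i, ∀ J : Finset ι, i ∉ J → J.card < finrank K (A ⊔ J.sup W : Submodule K E) := by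
  classical
  obtain ⟨A, hA, B, hB, hAB⟩ := exists_lt_lt_sup_eq hi
  by_contra! hcon
  obtain ⟨J₁, hi₁, h₁⟩ := hcon A hA
  obtain ⟨J₂, hi₂, h₂⟩ := hcon B hB
  have hsup : (insert i (J₁ ∪ J₂)).sup W ≤ (A ⊔ J₁.sup W) ⊔ (B ⊔ J₂.sup W) := by
    rw [Finset.sup_insert, Finset.sup_union, ← hAB, sup_sup_sup_comm]
  have hinf : (J₁ ∩ J₂).sup W ≤ (A ⊔ J₁.sup W) ⊓ (B ⊔ J₂.sup W) :=
    le_inf (le_sup_of_le_right (Finset.sup_mono Finset.inter_subset_left))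
      (le_sup_of_le_right (Finset.sup_mono Finset.inter_subset_right))
  have hsup' := (hW _).trans (Submodule.finrank_mono hsup)
  have hinf' := (hW _).trans (Submodule.finrank_mono hinf)
  rw [Finset.card_insert_of_notMem (by simp [hi₁, hi₂])] at hsup'
  have hmod := Submodule.finrank_sup_add_finrank_inf_eq (A ⊔ J₁.sup W) (B ⊔ J₂.sup W)
  have hcard := Finset.card_union_add_card_inter J₁ J₂
  omega

/-- Rado's theorem for subspaces. Families that are minimal with the rank condition consist of
lines, by the modularity of the dimension. -/
theorem exists_linearIndependent_mem_of_card_le_finrank_sup [Finite ι] {W : ι → Submodule K E}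
    (hW : ∀ J : Finset ι, J.card ≤ finrank K (J.sup W : Submodule K E)) :
    ∃ w : ι → E, (∀ i, w i ∈ W i) ∧ LinearIndependent K w := by
  classical
  have := Fintype.ofFinite ι
  obtain ⟨W', hle, hmin⟩ := exists_minimal_le_of_wellFoundedLT
    (fun W : ι → Submodule K E => ∀ J : Finset ι, J.card ≤ finrank K (J.sup W : Submodule K E)) W hW
  have hline : ∀ i, finrank K (W' i) ≤ 1 := fun i => by
    by_contra! hi
    obtain ⟨A, hA, hJ⟩ := exists_lt_forall_card_lt_finrank_sup hmin.prop hi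
    refine hmin.not_prop_of_lt (y := Function.update W' i A) (by simpa using hA) fun J => ?_
    have hoff : ∀ J' : Finset ι, i ∉ J' → J'.sup (Function.update W' i A) = J'.sup W' :=
      fun J' hi' => Finset.sup_congr rfl fun j hj =>
        Function.update_of_ne (ne_of_mem_of_not_mem hj hi') _ _
    by_cases hiJ : i ∈ J
    · rw [← Finset.insert_erase hiJ, Finset.sup_insert, Function.update_self,
        hoff _ (Finset.notMem_erase i J), Finset.card_insert_of_notMem (Finset.notMem_erase i J)]
      exact hJ _ (Finset.notMem_erase i J)
    · rw [hoff J hiJ]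
      exact hmin.prop J
  choose w hw using fun i => finrank_le_one_iff.1 (hline i)
  refine ⟨fun i => w i, fun i => hle i (w i).2, linearIndependent_iff_card_le_finrank_span.2 ?_⟩
  refine (hmin.prop Finset.univ).trans (Submodule.finrank_mono (Finset.sup_le fun i _ v hv => ?_))
  obtain ⟨c, hc⟩ := hw i ⟨v, hv⟩
  rw [show v = c • (w i : E) from congrArg Subtype.val hc.symm]
  exact Submodule.smul_mem _ _ (Submodule.subset_span ⟨i, rfl⟩)

end Rado

theorem exists_finite_field_extension_card_gt (F : Type u) [Field F] [Finite F] (n : ℕ) :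
    ∃ (K : Type u) (_ : Field K) (_ : Finite K) (_ : Algebra F K), n < Nat.card K := by
  obtain ⟨s, hs⟩ := Infinite.exists_subset_card_eq (AlgebraicClosure F) (n + 1)
  let E := IntermediateField.adjoin F (s : Set (AlgebraicClosure F))
  have : FiniteDimensional F E := IntermediateField.finiteDimensional_adjoin fun x _ =>
    Algebra.IsIntegral.isIntegral x
  have : Finite E := Module.finite_of_finite F
  refine ⟨E, inferInstance, inferInstance, inferInstance, ?_⟩
  have hsE : (s : Set (AlgebraicClosure F)) ⊆ E := IntermediateField.subset_adjoin F _
  have := Set.ncard_le_ncard hsE (Set.toFinite _)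
  rw [Set.ncard_coe_finset, hs] at this
  exact this

section MaskedMatrix
open Matrix Module

variable {m n K : Type*}

open Classical in
/-- The matrix with the entries `a` at the positions that satisfy `r`, and zeros elsewhere. The
coefficients of a network code form such matrices, because only the coefficients between ports of
the same supernode count. -/
noncomputable def maskedMatrix [Zero K] (r : m → n → Prop) (a : m × n → K) : Matrix m n K :=
  of fun i j => if r i j then a (i, j) else 0

theorem maskedMatrix_apply_of_not [Zero K] {r : m → n → Prop} (a : m × n → K) {i : m} {j : n}
    (h : ¬ r i j) : maskedMatrix r a i j = 0 :=
  if_neg h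

theorem map_maskedMatrix {F : Type*} [Semiring F] [Semiring K] (φ : F →+* K) (r : m → n → Prop)
    (a : m × n → F) : (maskedMatrix r a).map φ = maskedMatrix r (φ ∘ a) := by
  ext i j
  by_cases h : r i j <;> simp [maskedMatrix, h]

theorem maskedMatrix_eq_self [Zero K] {r : m → n → Prop} {A : Matrix m n K}
    (hA : ∀ i j, ¬ r i j → A i j = 0) : maskedMatrix r (fun x => A x.1 x.2) = A := by
  ext i j
  by_cases h : r i j <;> simp [maskedMatrix, h, hA]

theorem maskedMatrix_update_of_not [DecidableEq m] [DecidableEq n] [Zero K] {r : m → n → Prop}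
    (a : m × n → K) {i : m} {j : n} (h : ¬ r i j) (t : K) :
    maskedMatrix r (Function.update a (i, j) t) = maskedMatrix r a := by
  ext i' j'
  by_cases hij : (i', j') = (i, j)
  · obtain ⟨rfl, rfl⟩ := Prod.mk.inj hij
    simp [maskedMatrix, h]
  · simp [maskedMatrix, hij]

theorem maskedMatrix_update [DecidableEq m] [DecidableEq n] [Ring K] {r : m → n → Prop}
    (a : m × n → K) {i : m} {j : n} (h : r i j) (t : K) :
    maskedMatrix r (Function.update a (i, j) t) =
      maskedMatrix r a + (t - a (i, j)) • vecMulVec (Pi.single i 1) (Pi.single j 1) := by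
  ext i' j'
  by_cases hij : (i', j') = (i, j)
  · obtain ⟨rfl, rfl⟩ := Prod.mk.inj hij
    simp [maskedMatrix, h, vecMulVec_apply]
  · have hzero : (Pi.single i 1 : m → K) i' * (Pi.single j 1 : n → K) j' = 0 := by
      by_cases hi : i' = i
      · have hj : j' ≠ j := fun hj => hij (by rw [hi, hj])
        simp [hj]
      · simp [hi]
    simp [maskedMatrix, hij, vecMulVec_apply, hzero]

theorem isRankOneAffine_maskedMatrix [DecidableEq m] [DecidableEq n] [Ring K] (r : m → n → Prop) :
    IsRankOneAffine (maskedMatrix (K := K) r) := by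
  rintro a ⟨i, j⟩
  by_cases h : r i j
  · exact ⟨_, _, maskedMatrix_update a h⟩
  · exact ⟨0, 0, fun t => by simp [maskedMatrix_update_of_not a h]⟩

theorem exists_maskedMatrix_mul_row_eq {l m n K : Type*} [Fintype m] [Field K] (r : l → m → Prop)
    {A : Matrix m n K} {w : l → n → K}
    (hw : ∀ i, w i ∈ Submodule.span K (A.row '' {j | r i j})) :
    ∃ a : l × m → K, ∀ i, (maskedMatrix r a * A).row i = w i := by
  classical
  have hc : ∀ i, ∃ c : m → K, ∑ j with r i j, c j • A.row j = w i := fun i => by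
    rw [← Submodule.mem_span_image_finset_iff_exists_fun', Finset.coe_filter_univ]
    exact hw i
  choose c hc using hc
  refine ⟨fun x => c x.1 x.2, fun i => ?_⟩
  rw [← hc i]
  ext k
  simp [mul_apply, maskedMatrix, Finset.sum_filter]

theorem maskedMatrix_mul_row_mem_span {l m n K : Type*} [Fintype m] [Field K] (r : l → m → Prop)
    (a : l × m → K) (A : Matrix m n K) (i : l) :
    (maskedMatrix r a * A).row i ∈ Submodule.span K (A.row '' {j | r i j}) := by
  have hsum : (maskedMatrix r a * A).row i = ∑ j, maskedMatrix r a i j • A.row j := by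
    ext k
    simp [mul_apply]
  rw [hsum]
  refine Submodule.sum_mem _ fun j _ => ?_
  by_cases h : r i j
  · exact Submodule.smul_mem _ _ (Submodule.subset_span ⟨j, h, rfl⟩)
  · simp [maskedMatrix_apply_of_not a h]

theorem exists_linearIndependent_mem_span_iff {l m n K : Type*} [Fintype l] [Fintype m] [Fintype n]
    [Field K] {r : l → m → Prop} {A : Matrix m n K} :
    (∃ w : l → n → K, (∀ i, w i ∈ Submodule.span K (A.row '' {j | r i j})) ∧
      LinearIndependent K w) ↔ ∃ a : l × m → K, Fintype.card l ≤ (maskedMatrix r a * A).rank := by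
  simp only [← linearIndependent_row_iff_card_le_rank]
  constructor
  · rintro ⟨w, hw, hind⟩
    obtain ⟨a, ha⟩ := exists_maskedMatrix_mul_row_eq r hw
    exact ⟨a, by rwa [funext ha]⟩
  · rintro ⟨a, ha⟩
    exact ⟨_, maskedMatrix_mul_row_mem_span r a A, ha⟩

end MaskedMatrix

namespace ADTNetwork
open Matrix Module

variable {V I O : Type*} {G : ADTNetwork V I O}

/-- The number of output ports from whose supernodes `v` can be reached. In an acyclic network it
increases along the edges, so that it serves as a topological order of the supernodes. -/
noncomputable def height (G : ADTNetwork V I O) (v : V) : ℕ :=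
  {e | Relation.TransGen G.Adj (G.outNode e) v}.ncard

theorem Acyclic.height_lt_height [Finite O] (hG : G.Acyclic) {v w : V} (h : G.Adj v w) :
    G.height v < G.height w := by
  obtain ⟨e, b, rfl, rfl, _⟩ := id h
  exact Set.ncard_lt_ncard ⟨fun e' he' => he'.tail h, fun hle => hG _ (hle (.single h))⟩

section Matrices

variable {K : Type*} [Field K]

open Classical in
/-- The incidence matrix of the edges, which turns the symbols at the output ports into those at
the input ports. -/
noncomputable def edgeMatrix (G : ADTNetwork V I O) (K : Type*) [Field K] : Matrix I O K :=
  of fun b e => if G.edge e b then 1 else 0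

/-- The matrix of the coefficients `β` between the ports of the supernodes. -/
noncomputable def localMatrix (G : ADTNetwork V I O) (β : O × I → K) : Matrix O I K :=
  maskedMatrix (fun e b => G.inNode b = G.outNode e) β

/-- The matrix of the coefficients `α` at the output ports of the source. -/
noncomputable def sourceMatrix (G : ADTNetwork V I O) {μ : ℕ} (S : V) (α : O × Fin μ → K) :
    Matrix O (Fin μ) K :=
  maskedMatrix (fun e _ => G.outNode e = S) α

theorem map_edgeMatrix {F : Type*} [Field F] (φ : F →+* K) :
    (G.edgeMatrix F).map φ = G.edgeMatrix K := by
  ext b e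
  by_cases h : G.edge e b <;> simp [edgeMatrix, h]

theorem map_cutMatrix {F : Type*} [Field F] (φ : F →+* K) (Ω : Finset V) :
    (G.cutMatrix F Ω).map φ = G.cutMatrix K Ω := by
  ext e b
  by_cases h : G.edge e b <;> simp [cutMatrix, h]

section Mincut

variable [DecidableEq V] [Fintype I]

theorem rank_cutMatrix_eq_of_ringHom [Finite O] {F : Type*} [Field F] (φ : F →+* K)
    (Ω : Finset V) : (G.cutMatrix F Ω).rank = (G.cutMatrix K Ω).rank := by
  rw [← map_cutMatrix φ, rank_map_ringHom]

theorem le_mincut_iff {S : V} {D : Finset V} (hD : S ∉ D) {n : ℕ} :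
    n ≤ G.mincut K S D ↔
      ∀ Ω : Finset V, S ∈ Ω → Disjoint D Ω → n ≤ (G.cutMatrix K Ω).rank := by
  refine ⟨fun h Ω hΩ hdisj => h.trans (Nat.sInf_le ⟨Ω, hΩ, hdisj, rfl⟩), fun h => ?_⟩
  refine le_csInf ⟨_, {S}, Finset.mem_singleton_self S,
    Finset.disjoint_singleton_right.2 hD, rfl⟩ ?_
  rintro _ ⟨Ω, hΩ, hdisj, rfl⟩
  exact h Ω hΩ hdisj

theorem mincut_eq_of_ringHom [Finite O] {F : Type*} [Field F] (φ : F →+* K) (S : V) (D : Finset V) :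
    G.mincut F S D = G.mincut K S D := by
  simp only [mincut, rank_cutMatrix_eq_of_ringHom φ]

end Mincut

theorem inNode_eq_of_localMatrix_ne_zero {β : O × I → K} {e : O} {b : I}
    (h : G.localMatrix β e b ≠ 0) : G.inNode b = G.outNode e := by
  by_contra hbe
  exact h (maskedMatrix_apply_of_not β hbe)

theorem edge_of_edgeMatrix_ne_zero {e : O} {b : I} (h : G.edgeMatrix K b e ≠ 0) : G.edge e b := by
  by_contra hbe
  exact h (if_neg hbe)

theorem Acyclic.height_lt_of_edgeMatrix_ne_zero [Finite O] (hG : G.Acyclic) {e : O} {b : I}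
    (h : G.edgeMatrix K b e ≠ 0) : G.height (G.outNode e) < G.height (G.inNode b) :=
  hG.height_lt_height ⟨e, b, rfl, rfl, edge_of_edgeMatrix_ne_zero h⟩

variable [Fintype O]

theorem Acyclic.height_lt_of_edgeMatrix_mul_localMatrix_ne_zero (hG : G.Acyclic) {β : O × I → K}
    {b b' : I} (h : (G.edgeMatrix K * G.localMatrix β) b b' ≠ 0) :
    G.height (G.inNode b') < G.height (G.inNode b) := by
  obtain ⟨e, -, he⟩ := Finset.exists_ne_zero_of_sum_ne_zero h
  rw [inNode_eq_of_localMatrix_ne_zero (right_ne_zero_of_mul he)]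
  exact hG.height_lt_of_edgeMatrix_ne_zero (left_ne_zero_of_mul he)

variable [Fintype I]

theorem Acyclic.isUnit_one_sub_edgeMatrix_mul_localMatrix [DecidableEq I] (hG : G.Acyclic)
    (β : O × I → K) :
    IsUnit (1 - G.edgeMatrix K * G.localMatrix β) :=
  (isNilpotent_of_forall_ne_zero_lt (fun b => G.height (G.inNode b)) fun _ _ =>
    hG.height_lt_of_edgeMatrix_mul_localMatrix_ne_zero).isUnit_one_sub

open Classical in
/-- The response of the input ports to symbols injected at the output ports: if `Z` is added to the
symbols of the output ports, then `G.response β * Z` are the symbols at the input ports. -/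
noncomputable def response (G : ADTNetwork V I O) (β : O × I → K) : Matrix I O K :=
  (1 - G.edgeMatrix K * G.localMatrix β)⁻¹ * G.edgeMatrix K

theorem Acyclic.eq_response_mul_iff (hG : G.Acyclic) {n : Type*} {β : O × I → K} {Y : Matrix I n K}
    {Z : Matrix O n K} :
    Y = G.edgeMatrix K * (G.localMatrix β * Y + Z) ↔ Y = G.response β * Z := by
  classical
  have := (hG.isUnit_one_sub_edgeMatrix_mul_localMatrix β).invertible
  rw [response, Matrix.mul_assoc, eq_comm (b := _⁻¹ * _), inv_mul_eq_iff_eq_mul_of_invertible,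
    Matrix.sub_mul, Matrix.one_mul, Matrix.mul_add, Matrix.mul_assoc, eq_sub_iff_add_eq',
    eq_comm]

theorem Acyclic.response_eq [DecidableEq O] (hG : G.Acyclic) (β : O × I → K) :
    G.response β = G.edgeMatrix K * (G.localMatrix β * G.response β + 1) :=
  hG.eq_response_mul_iff.2 (Matrix.mul_one _).symm

theorem Acyclic.height_lt_of_response_ne_zero (hG : G.Acyclic) {β : O × I → K} {b : I} {e : O}
    (h : G.response β b e ≠ 0) : G.height (G.outNode e) < G.height (G.inNode b) := by
  classical
  induction hn : G.height (G.inNode b) using Nat.strong_induction_on generalizing b with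
  | _ n ih =>
    rw [hG.response_eq, mul_apply] at h
    obtain ⟨o, -, ho⟩ := Finset.exists_ne_zero_of_sum_ne_zero h
    have hob := hG.height_lt_of_edgeMatrix_ne_zero (left_ne_zero_of_mul ho)
    rw [hn] at hob
    obtain rfl | hoe := eq_or_ne o e
    · exact hob
    · have hBR := right_ne_zero_of_mul ho
      rw [Matrix.add_apply, one_apply_ne hoe, add_zero, mul_apply] at hBR
      obtain ⟨b', -, hb'⟩ := Finset.exists_ne_zero_of_sum_ne_zero hBR
      rw [← inNode_eq_of_localMatrix_ne_zero (left_ne_zero_of_mul hb')] at hob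
      exact (ih _ hob (right_ne_zero_of_mul hb') rfl).trans hob

theorem Acyclic.map_response {F : Type*} [Field F] (hG : G.Acyclic) (φ : F →+* K) (β : O × I → F) :
    (G.response β).map φ = G.response (φ ∘ β) := by
  classical
  rw [← Matrix.mul_one (G.response (φ ∘ β)), ← hG.eq_response_mul_iff]
  conv_lhs => rw [hG.response_eq]
  rw [Matrix.map_mul, Matrix.map_add _ (map_add φ), Matrix.map_mul, map_edgeMatrix, localMatrix,
    map_maskedMatrix, Matrix.map_one _ (map_zero φ) (map_one φ), localMatrix]

theorem Acyclic.response_update [DecidableEq O] [DecidableEq I] (hG : G.Acyclic) (β : O × I → K)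
    {e : O} {b : I} (h : G.inNode b = G.outNode e) (t : K) :
    G.response (Function.update β (e, b) t) = G.response β +
      (t - β (e, b)) • vecMulVec ((G.response β).col e) ((G.response β).row b) := by
  have hbe : G.response β b e = 0 := by
    by_contra hne
    exact (h ▸ hG.height_lt_of_response_ne_zero hne).false
  have hlocal : G.localMatrix (Function.update β (e, b) t) = G.localMatrix β +
      (t - β (e, b)) • vecMulVec (Pi.single e 1) (Pi.single b 1) := maskedMatrix_update β h t
  have hR := hG.response_eq β
  generalize G.response β = R at hbe hR ⊢
  have hrow : Pi.single b 1 ᵥ* vecMulVec (R.col e) (R.row b) = 0 := by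
    simp [vecMul_vecMulVec, hbe]
  have hW : vecMulVec (R.col e) (R.row b) = G.edgeMatrix K *
      (G.localMatrix β * vecMulVec (R.col e) (R.row b) + vecMulVec (Pi.single e 1) (R.row b)) := by
    have hcol : vecMulVec (R.col e) (R.row b) = R * vecMulVec (Pi.single e 1) (R.row b) := by
      rw [mul_vecMulVec, mulVec_single_one]
    have := congrArg (· * vecMulVec (Pi.single e 1) (R.row b)) hR
    simpa only [Matrix.mul_assoc, Matrix.add_mul, Matrix.one_mul, ← hcol] using this
  rw [← Matrix.mul_one (G.response (Function.update β (e, b) t)), eq_comm,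
    ← hG.eq_response_mul_iff, hlocal]
  calc R + (t - β (e, b)) • vecMulVec (R.col e) (R.row b)
      = G.edgeMatrix K * (G.localMatrix β * R + 1) + (t - β (e, b)) • (G.edgeMatrix K *
          (G.localMatrix β * vecMulVec (R.col e) (R.row b) +
            vecMulVec (Pi.single e 1) (R.row b))) := by rw [← hR, ← hW]
    _ = _ := by
      rw [Matrix.add_mul, smul_mul, vecMulVec_mul, vecMul_add, vecMul_smul, hrow, smul_zero,
        add_zero, single_one_vecMul]
      simp only [Matrix.mul_add, Matrix.mul_smul, smul_add]
      abel

theorem Acyclic.isRankOneAffine_response [DecidableEq O] [DecidableEq I] (hG : G.Acyclic) :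
    IsRankOneAffine (G.response (K := K)) := by
  rintro β ⟨e, b⟩
  by_cases h : G.inNode b = G.outNode e
  · exact ⟨_, _, hG.response_update β h⟩
  · exact ⟨0, 0, fun t => by
      rw [response, localMatrix, maskedMatrix_update_of_not β h, zero_vecMulVec, smul_zero,
        add_zero, response, localMatrix]⟩

end Matrices

section Encoding

variable {K : Type*} [Field K] [Fintype I] [Fintype O] {S : V} {μ : ℕ}

/-- The matrix that turns the source symbols into the symbols at the input ports; `p` comprises the
coefficients `α` and `β`. -/
noncomputable def encoding (G : ADTNetwork V I O) (S : V) (p : (O × Fin μ) ⊕ (O × I) → K) :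
    Matrix I (Fin μ) K :=
  G.response (p ∘ Sum.inr) * G.sourceMatrix S (p ∘ Sum.inl)

theorem Acyclic.isRankOneAffine_encoding [DecidableEq O] [DecidableEq I] (hG : G.Acyclic) :
    IsRankOneAffine (G.encoding (K := K) (μ := μ) S) :=
  hG.isRankOneAffine_response.mul (isRankOneAffine_maskedMatrix _)

theorem Acyclic.map_encoding {F : Type*} [Field F] (hG : G.Acyclic) (φ : F →+* K)
    (p : (O × Fin μ) ⊕ (O × I) → F) : (G.encoding S p).map φ = G.encoding S (φ ∘ p) := by
  rw [encoding, Matrix.map_mul, hG.map_response, sourceMatrix, map_maskedMatrix]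
  rfl

theorem exists_encoding_eq_add_single (p : (O × Fin μ) ⊕ (O × I) → K) {e : O}
    (h : G.outNode e = S) (i : Fin μ) : ∃ p', G.encoding S p' =
      G.encoding S p + vecMulVec ((G.response (p ∘ Sum.inr)).col e) (Pi.single i 1) := by
  classical
  refine ⟨Function.update p (Sum.inl (e, i)) (p (Sum.inl (e, i)) + 1), ?_⟩
  rw [encoding, encoding, Sum.update_inl_comp_inl, Sum.update_inl_comp_inr, sourceMatrix,
    maskedMatrix_update (r := fun e _ => G.outNode e = S) _ h, Function.comp_apply,
    add_sub_cancel_left, one_smul, Matrix.mul_add, mul_vecMulVec, mulVec_single_one, sourceMatrix]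

theorem Acyclic.exists_encoding_eq_add_row (hG : G.Acyclic) (p : (O × Fin μ) ⊕ (O × I) → K) {e : O}
    {b : I} (h : G.inNode b = G.outNode e) : ∃ p', G.encoding S p' = G.encoding S p +
      vecMulVec ((G.response (p ∘ Sum.inr)).col e) ((G.encoding S p).row b) := by
  classical
  refine ⟨Function.update p (Sum.inr (e, b)) (p (Sum.inr (e, b)) + 1), ?_⟩
  rw [encoding, encoding, Sum.update_inr_comp_inl, Sum.update_inr_comp_inr,
    hG.response_update _ h, Function.comp_apply, add_sub_cancel_left, one_smul, Matrix.add_mul,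
    vecMulVec_mul]
  rfl

/-- The coefficients `p` are generic: for every set of input ports, the symbols at these ports are
as independent as the network allows. -/
def IsGeneric (G : ADTNetwork V I O) (S : V) (p : (O × Fin μ) ⊕ (O × I) → K) : Prop :=
  ∀ (s : Set I) (p' : (O × Fin μ) ⊕ (O × I) → K),
    finrank K (Submodule.span K ((G.encoding S p').row '' s)) ≤
      finrank K (Submodule.span K ((G.encoding S p).row '' s))

theorem Acyclic.exists_isGeneric [Infinite K] (hG : G.Acyclic) (S : V) (μ : ℕ) :
    ∃ p : (O × Fin μ) ⊕ (O × I) → K, G.IsGeneric S p := by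
  classical
  obtain ⟨p, hp⟩ := exists_forall_rank_le fun s : Set I =>
    hG.isRankOneAffine_encoding (K := K) (S := S) (μ := μ) |>.submatrix (Subtype.val : s → I)
  exact ⟨p, fun s p' => by
    simpa only [rank_submatrix_val_eq_finrank_span_image_row] using hp s p'⟩

theorem Acyclic.exists_encoding_eq_add_vecMulVec (hG : G.Acyclic)
    {p : (O × Fin μ) ⊕ (O × I) → K} {U : Submodule K (Fin μ → K)} (hU : U ≠ ⊤) {e : O}
    (he : G.outNode e = S ∨ ∃ b, (G.encoding S p).row b ∉ U ∧ G.inNode b = G.outNode e) :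
    ∃ q ∉ U, ∃ p', G.encoding S p' =
      G.encoding S p + vecMulVec ((G.response (p ∘ Sum.inr)).col e) q := by
  obtain he | ⟨b, hb, hbe⟩ := he
  · obtain ⟨i, hi⟩ : ∃ i, (Pi.single i 1 : Fin μ → K) ∉ U := by
      by_contra! hall
      refine hU (eq_top_iff.2 ?_)
      rw [← (Pi.basisFun K (Fin μ)).span_eq, Submodule.span_le]
      rintro _ ⟨i, rfl⟩
      simpa using hall i
    exact ⟨_, hi, exists_encoding_eq_add_single p he i⟩
  · exact ⟨_, hb, hG.exists_encoding_eq_add_row p hbe⟩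

section Cuts

variable [DecidableEq V] {Ω : Finset V}

theorem Acyclic.toBlock_response_eq [DecidableEq O] (hG : G.Acyclic) (β : O × I → K)
    (Ω : Finset V) :
    (G.response β).toBlock (G.inNode · ∉ Ω) (G.outNode · ∈ Ω) =
      (G.cutMatrix K Ω)ᵀ *
          ((G.localMatrix β * G.response β).toBlock (G.outNode · ∈ Ω) (G.outNode · ∈ Ω) + 1) +
        (G.edgeMatrix K).toBlock (G.inNode · ∉ Ω) (G.outNode · ∉ Ω) *
          (G.localMatrix β).toBlock (G.outNode · ∉ Ω) (G.inNode · ∉ Ω) *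
          (G.response β).toBlock (G.inNode · ∉ Ω) (G.outNode · ∈ Ω) := by
  have hlocal : (G.localMatrix β).toBlock (G.outNode · ∉ Ω) (G.inNode · ∈ Ω) = 0 := by
    ext e b
    exact not_not.1 fun hne => e.2 (inNode_eq_of_localMatrix_ne_zero hne ▸ b.2)
  have hdisj : Disjoint (G.outNode · ∉ Ω) (G.outNode · ∈ Ω) := disjoint_compl_left
  have hadd : ∀ (p q : O → Prop) (A B : Matrix O O K),
      (A + B).toBlock p q = A.toBlock p q + B.toBlock p q := fun _ _ _ _ => rfl
  conv_lhs => rw [hG.response_eq β]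
  rw [toBlock_mul_eq_add _ (G.outNode · ∈ Ω), hadd, hadd, toBlock_one_self,
    toBlock_one_disjoint hdisj, add_zero, toBlock_mul_eq_add (G.outNode · ∉ Ω) (G.inNode · ∈ Ω),
    hlocal, Matrix.zero_mul, zero_add, ← Matrix.mul_assoc]
  rfl

theorem Acyclic.rank_cutMatrix_eq_rank_response (hG : G.Acyclic) (β : O × I → K) (Ω : Finset V) :
    (G.cutMatrix K Ω).rank =
      ((G.response β).toBlock (G.inNode · ∉ Ω) (G.outNode · ∈ Ω)).rank := by
  classical
  set N := (G.edgeMatrix K).toBlock (G.inNode · ∉ Ω) (G.outNode · ∉ Ω) *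
    (G.localMatrix β).toBlock (G.outNode · ∉ Ω) (G.inNode · ∉ Ω) with hN
  set Z := (G.localMatrix β * G.response β).toBlock (G.outNode · ∈ Ω) (G.outNode · ∈ Ω) with hZ
  have hN' : IsUnit (1 - N) := by
    refine (isNilpotent_of_forall_ne_zero_lt (fun b => G.height (G.inNode b.1))
      fun b b' h => ?_).isUnit_one_sub
    obtain ⟨e, -, he⟩ := Finset.exists_ne_zero_of_sum_ne_zero h
    rw [inNode_eq_of_localMatrix_ne_zero (right_ne_zero_of_mul he)]
    exact hG.height_lt_of_edgeMatrix_ne_zero (left_ne_zero_of_mul he)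
  have hZ' : IsUnit (Z + 1) := by
    refine (isNilpotent_of_forall_ne_zero_lt (fun e => G.height (G.outNode e.1))
      fun e e' h => ?_).isUnit_add_one
    obtain ⟨b, -, hb⟩ := Finset.exists_ne_zero_of_sum_ne_zero h
    rw [← inNode_eq_of_localMatrix_ne_zero (left_ne_zero_of_mul hb)]
    exact hG.height_lt_of_response_ne_zero (right_ne_zero_of_mul hb)
  have hR := hG.toBlock_response_eq β Ω
  rw [← hN, ← hZ] at hR
  rw [← rank_mul_eq_right_of_isUnit_det _ _ ((isUnit_iff_isUnit_det _).1 hN'), Matrix.sub_mul,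
    Matrix.one_mul, sub_eq_iff_eq_add.2 hR,
    rank_mul_eq_left_of_isUnit_det _ _ ((isUnit_iff_isUnit_det _).1 hZ'), rank_transpose]

theorem encoding_submatrix_eq_mul (p : (O × Fin μ) ⊕ (O × I) → K) (hS : S ∈ Ω) :
    (G.encoding S p).submatrix (Subtype.val : {b | G.inNode b ∉ Ω} → I) id =
      (G.response (p ∘ Sum.inr)).toBlock (G.inNode · ∉ Ω) (G.outNode · ∈ Ω) *
        (G.sourceMatrix S (p ∘ Sum.inl)).submatrix Subtype.val id := by
  ext b i
  have hsource : ∀ e : {e // G.outNode e ∉ Ω}, G.sourceMatrix S (p ∘ Sum.inl) e.1 i = 0 :=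
    fun e => maskedMatrix_apply_of_not _ fun h : G.outNode e.1 = S => e.2 (h ▸ hS)
  refine (Fintype.sum_subtype_add_sum_subtype (G.outNode · ∈ Ω) fun e =>
    G.response (p ∘ Sum.inr) b e * G.sourceMatrix S (p ∘ Sum.inl) e i).symm.trans ?_
  simp only [hsource, mul_zero, Finset.sum_const_zero, add_zero]
  rfl

theorem Acyclic.finrank_span_encoding_row_le (hG : G.Acyclic) (p : (O × Fin μ) ⊕ (O × I) → K)
    (hS : S ∈ Ω) :
    finrank K (Submodule.span K ((G.encoding S p).row '' {b | G.inNode b ∉ Ω})) ≤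
      (G.cutMatrix K Ω).rank := by
  rw [← rank_submatrix_val_eq_finrank_span_image_row, encoding_submatrix_eq_mul p hS,
    hG.rank_cutMatrix_eq_rank_response (p ∘ Sum.inr)]
  exact rank_mul_le_left _ _

theorem IsGeneric.finrank_span_encoding_row_eq {p : (O × Fin μ) ⊕ (O × I) → K}
    (hp : G.IsGeneric S p) (hG : G.Acyclic)
    {U : Submodule K (Fin μ → K)} (hU : U ≠ ⊤)
    (hΩ : ∀ v, v ∈ Ω ↔ v = S ∨ ∃ b, (G.encoding S p).row b ∉ U ∧ G.inNode b = v) :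
    finrank K (Submodule.span K ((G.encoding S p).row '' {b | G.inNode b ∉ Ω})) =
      (G.cutMatrix K Ω).rank := by
  classical
  refine (hG.finrank_span_encoding_row_le p ((hΩ S).2 (.inl rfl))).antisymm ?_
  simp only [IsGeneric, ← rank_submatrix_val_eq_finrank_span_image_row] at hp ⊢
  set A := (G.encoding S p).submatrix (Subtype.val : {b | G.inNode b ∉ Ω} → I) id
  rw [hG.rank_cutMatrix_eq_rank_response (p ∘ Sum.inr), rank_eq_finrank_span_cols,
    rank_eq_finrank_span_cols]
  refine Submodule.finrank_mono (Submodule.span_le.2 ?_)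
  rintro _ ⟨e, rfl⟩
  by_contra hcol
  obtain ⟨q, hqU, p', hp'⟩ := hG.exists_encoding_eq_add_vecMulVec hU ((hΩ _).1 e.2)
  have hrow : q ∉ Submodule.span K (Set.range A.row) := fun hq => by
    refine hqU (Submodule.span_le.2 ?_ hq)
    rintro _ ⟨b, rfl⟩
    by_contra hb
    exact b.2 ((hΩ _).2 (.inr ⟨b, hb, rfl⟩))
  have hlt := rank_lt_rank_add_vecMulVec A hcol hrow
  refine (hp {b | G.inNode b ∉ Ω} p').not_gt ?_
  rw [hp']
  exact hlt

theorem IsGeneric.le_finrank_span_encoding_row {p : (O × Fin μ) ⊕ (O × I) → K}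
    (hp : G.IsGeneric S p) (hG : G.Acyclic) {D : Finset V} (hD : S ∉ D) {n : ℕ} (hn : n ≤ μ)
    (hcut : n ≤ G.mincut K S D) :
    n ≤ finrank K (Submodule.span K ((G.encoding S p).row '' {b | G.inNode b ∈ D})) := by
  classical
  set U := Submodule.span K ((G.encoding S p).row '' {b | G.inNode b ∈ D}) with hU
  by_cases htop : U = ⊤
  · rwa [htop, finrank_top, finrank_fin_fun]
  set Ω : Finset V := insert S (({b | (G.encoding S p).row b ∉ U} : Finset I).image G.inNode)
  have hΩ : ∀ v, v ∈ Ω ↔ v = S ∨ ∃ b, (G.encoding S p).row b ∉ U ∧ G.inNode b = v := by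
    simp [Ω]
  have hdisj : Disjoint D Ω := Finset.disjoint_left.2 fun v hv hvΩ => by
    obtain rfl | ⟨b, hb, rfl⟩ := (hΩ v).1 hvΩ
    · exact hD hv
    · exact hb (Submodule.subset_span ⟨b, hv, rfl⟩)
  calc n ≤ (G.cutMatrix K Ω).rank := (le_mincut_iff hD).1 hcut Ω ((hΩ S).2 (.inl rfl)) hdisj
    _ = finrank K (Submodule.span K ((G.encoding S p).row '' {b | G.inNode b ∉ Ω})) :=
      (hp.finrank_span_encoding_row_eq hG htop hΩ).symm
    _ ≤ finrank K U := by
      refine Submodule.finrank_mono (Submodule.span_le.2 ?_)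
      rintro _ ⟨b, hb, rfl⟩
      by_contra hbU
      exact hb ((hΩ _).2 (.inr ⟨b, hbU, rfl⟩))

end Cuts

theorem isTransmission_iff {c : LinearCode V I O μ K} {x : Fin μ → K} {yIn : I → K}
    {yOut : O → K} : G.IsTransmission S c x yIn yOut ↔
      yOut = G.localMatrix (fun x => c.β x.2 x.1) *ᵥ yIn +
        G.sourceMatrix S (fun x => c.α x.2 x.1) *ᵥ x ∧ yIn = G.edgeMatrix K *ᵥ yOut := by
  classical
  rw [IsTransmission, funext_iff, funext_iff]
  refine and_congr (forall_congr' fun e => ?_) (forall_congr' fun b => ?_)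
  · by_cases he : G.outNode e = S <;>
      simp [mulVec, dotProduct, localMatrix, sourceMatrix, maskedMatrix, Finset.sum_filter, he]
  · simp [mulVec, dotProduct, edgeMatrix, Finset.sum_filter]

/-- The coefficients `α` and `β` of a code, in the order in which `encoding` takes them. -/
def codeCoeff (c : LinearCode V I O μ K) : (O × Fin μ) ⊕ (O × I) → K :=
  Sum.elim (fun x => c.α x.2 x.1) fun x => c.β x.2 x.1

theorem Acyclic.exists_isTransmission_iff (hG : G.Acyclic) {c : LinearCode V I O μ K}
    {x : Fin μ → K} {yIn : I → K} :
    (∃ yOut, G.IsTransmission S c x yIn yOut) ↔ yIn = G.encoding S (codeCoeff c) *ᵥ x := by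
  simp only [isTransmission_iff, exists_eq_left]
  rw [encoding, ← mulVec_mulVec, ← replicateCol_inj (ι := Unit), ← replicateCol_inj (ι := Unit),
    replicateCol_mulVec, replicateCol_mulVec, replicateCol_add, replicateCol_mulVec]
  exact hG.eq_response_mul_iff

theorem Acyclic.solvableOver_iff (hG : G.Acyclic) {C : Set (Connection V μ)} :
    G.SolvableOver K S C ↔ ∃ p : (O × Fin μ) ⊕ (O × I) → K, ∀ d ∈ C, ∀ i ∈ d.demand,
      Pi.single i 1 ∈ Submodule.span K ((G.encoding S p).row '' {b | G.inNode b = d.dest}) := by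
  classical
  have hspan : ∀ (p : (O × Fin μ) ⊕ (O × I) → K) (t : V) (i : Fin μ),
      Pi.single i 1 ∈ Submodule.span K ((G.encoding S p).row '' {b | G.inNode b = t}) ↔
        ∃ ε : I → K, ∀ x : Fin μ → K,
          ∑ b with G.inNode b = t, ε b * (G.encoding S p *ᵥ x) b = x i := fun p t i => by
    rw [← single_mem_span_row_image_iff, Finset.coe_filter_univ]
  simp only [hspan]
  constructor
  · rintro ⟨c, hc⟩
    refine ⟨codeCoeff c, fun d hd i hi => ⟨c.ε d.dest i, fun x => ?_⟩⟩
    obtain ⟨yIn, yOut, hy, hout⟩ := hc x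
    rw [← hG.exists_isTransmission_iff.1 ⟨yOut, hy⟩, ← hout d hd i hi, output]
  · rintro ⟨p, hp⟩
    choose! ε hε using fun (t : V) (i : Fin μ) (h : ∃ ε : I → K, ∀ x : Fin μ → K,
      ∑ b with G.inNode b = t, ε b * (G.encoding S p *ᵥ x) b = x i) => h
    let c : LinearCode V I O μ K := ⟨fun i e => p (.inl (e, i)), fun b e => p (.inr (e, b)), ε⟩
    have hc : codeCoeff c = p := funext (Sum.rec (fun _ => rfl) fun _ => rfl)
    refine ⟨c, fun x => ?_⟩
    obtain ⟨yOut, hy⟩ : ∃ yOut, G.IsTransmission S c x (G.encoding S p *ᵥ x) yOut :=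
      hG.exists_isTransmission_iff.2 (by rw [hc])
    refine ⟨_, yOut, hy, fun d hd i hi => ?_⟩
    rw [← hε d.dest i (hp d hd i hi) x, output]

end Encoding

section TwoLevel

variable {K : Type*} [Field K] [Fintype I] {S : V} {μ : ℕ}

theorem twoLevelCutConditions_iff_of_ringHom [DecidableEq V] [Finite O] {F : Type*} [Field F]
    (φ : F →+* K) {k l : ℕ} {T : Fin k → V} {T' : Fin l → V} {X : Fin k → Finset (Fin μ)} :
    TwoLevelCutConditions G F S T X T' ↔ TwoLevelCutConditions G K S T X T' := by
  simp only [TwoLevelCutConditions, mincut_eq_of_ringHom φ]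

theorem card_le_mincut_of_twoLevelCutConditions [DecidableEq V] {k l : ℕ} {T : Fin k → V}
    {T' : Fin l → V} {X : Fin k → Finset (Fin μ)} (h : TwoLevelCutConditions G K S T X T')
    (J : Finset (Σ t, X t)) : J.card ≤ G.mincut K S (J.image fun x => T x.1) := by
  classical
  calc J.card ≤ ((J.image Sigma.fst).sigma fun t => (Finset.univ : Finset (X t))).card :=
        Finset.card_le_card fun x hx =>
          Finset.mem_sigma.2 ⟨Finset.mem_image_of_mem _ hx, Finset.mem_univ _⟩
    _ = ∑ t ∈ J.image Sigma.fst, (X t).card := by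
      simp only [Finset.card_sigma, Finset.card_univ, Fintype.card_coe]
    _ ≤ G.mincut K S ((J.image Sigma.fst).image T) := h.1 _
    _ = G.mincut K S (J.image fun x => T x.1) := by rw [Finset.image_image]; rfl

variable [Fintype O] {P ι : Type*}

theorem exists_encoding_row_eq (p : (O × Fin μ) ⊕ (O × I) → K)
    (g : (Fin μ → K) →ₗ[K] (Fin μ → K)) :
    ∃ p', ∀ b, (G.encoding S p').row b = g ((G.encoding S p).row b) := by
  set A := G.sourceMatrix S (p ∘ Sum.inl) * (LinearMap.toMatrix' g)ᵀ with hA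
  have hmask : maskedMatrix (fun e _ => G.outNode e = S) (fun x => A x.1 x.2) = A :=
    maskedMatrix_eq_self fun e i (he : G.outNode e ≠ S) => by
      rw [hA, mul_apply]
      exact Finset.sum_eq_zero fun j _ => mul_eq_zero_of_left
        (maskedMatrix_apply_of_not (r := fun e _ => G.outNode e = S) _ he) _
  refine ⟨Sum.elim (fun x => A x.1 x.2) (p ∘ Sum.inr), fun b => ?_⟩
  rw [encoding, Sum.elim_comp_inr, Sum.elim_comp_inl, sourceMatrix, hmask, hA, ← Matrix.mul_assoc,
    ← encoding]
  exact (vecMul_transpose _ _).trans (LinearMap.toMatrix'_mulVec g _)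

theorem Acyclic.solvableOver_of_linearIndependent (hG : G.Acyclic) {C : Set (Connection V μ)}
    {p : (O × Fin μ) ⊕ (O × I) → K} {w : P → Fin μ → K} (hw : LinearIndependent K w) {j : P → Fin μ}
    (hj : Function.Injective j) (hC : ∀ d ∈ C, ∀ i ∈ d.demand,
      Submodule.span K ((G.encoding S p).row '' {b | G.inNode b = d.dest}) = ⊤ ∨ ∃ t, j t = i ∧
        w t ∈ Submodule.span K ((G.encoding S p).row '' {b | G.inNode b = d.dest})) :
    G.SolvableOver K S C := by
  have hsingle : LinearIndependent K fun t => (Pi.single (j t) 1 : Fin μ → K) :=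
    (Pi.linearIndependent_single_one (Fin μ) K).comp j hj
  obtain ⟨g, hg⟩ := exists_linearEquiv_forall_apply_eq hw hsingle
  obtain ⟨p', hp'⟩ := exists_encoding_row_eq (G := G) (S := S) p (g : (Fin μ → K) →ₗ[K] Fin μ → K)
  refine hG.solvableOver_iff.2 ⟨p', fun d hd i hi => ?_⟩
  have hrow : (G.encoding S p').row = g ∘ (G.encoding S p).row := funext hp'
  rw [hrow, Set.image_comp, ← LinearEquiv.coe_coe, ← Submodule.map_span]
  obtain htop | ⟨t, rfl, hwt⟩ := hC d hd i hi
  · rw [htop, Submodule.map_top, LinearEquiv.range]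
    exact Submodule.mem_top
  · exact ⟨w t, hwt, hg t⟩

theorem Acyclic.exists_le_rank_of_ringHom [Fintype P] [Fintype ι] {F : Type*} [Field F]
    (hG : G.Acyclic) (φ : F →+* K) (T : P → V) (T' : ι → V) {p : (O × Fin μ) ⊕ (O × I) → K}
    (hp : ∀ l, μ ≤ ((G.encoding S p).submatrix
      (Subtype.val : {b | G.inNode b = T' l} → I) id).rank) {ε : P × I → K}
    (hε : Fintype.card P ≤ (maskedMatrix (fun t b => G.inNode b = T t) ε * G.encoding S p).rank)
    {s : Finset F} (hs : Fintype.card ι + min (Fintype.card P) 1 < s.card) :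
    ∃ p₀ : (O × Fin μ) ⊕ (O × I) → F,
      (∀ l, μ ≤ ((G.encoding S p₀).submatrix
        (Subtype.val : {b | G.inNode b = T' l} → I) id).rank) ∧
      ∃ ε₀ : P × I → F,
        Fintype.card P ≤
          (maskedMatrix (fun t b => G.inNode b = T t) ε₀ * G.encoding S p₀).rank := by
  classical
  let good : ι ⊕ Fin (min (Fintype.card P) 1) → Set (((O × Fin μ) ⊕ (O × I)) ⊕ (P × I) → K) :=
    Sum.elim (fun l => {x | μ ≤ ((G.encoding S (x ∘ Sum.inl)).submatrix
        (Subtype.val : {b | G.inNode b = T' l} → I) id).rank})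
      fun _ => {x | Fintype.card P ≤
        (maskedMatrix (fun t b => G.inNode b = T t) (x ∘ Sum.inr) *
          G.encoding S (x ∘ Sum.inl)).rank}
  have henc := hG.isRankOneAffine_encoding (K := K) (S := S) (μ := μ)
  have hgood : ∀ i, ∀ x ∈ good i, ∀ v, {a | Function.update x v a ∉ good i}.Subsingleton := by
    rintro (l | _) x hx v
    · simpa only [good, Sum.elim_inl, Set.mem_ofPred, not_le] using
        ((henc.submatrix _).comp_inl).subsingleton_rank_lt hx v
    · simpa only [good, Sum.elim_inr, Set.mem_ofPred, not_le] using
        ((isRankOneAffine_maskedMatrix _).mul henc).subsingleton_rank_lt hx v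
  obtain ⟨x, hxs, hx⟩ := exists_mem_iInter_of_subsingleton_update_notMem
    (s := s.map ⟨φ, φ.injective⟩) (by simpa using hs) good hgood
    (Sum.rec (fun l => ⟨Sum.elim p ε, hp l⟩) fun _ => ⟨Sum.elim p ε, hε⟩)
  choose x₀ _ hx₀ using fun v => Finset.mem_map.1 (hxs v)
  obtain rfl : φ ∘ x₀ = x := funext hx₀
  refine ⟨x₀ ∘ Sum.inl, fun l => ?_, x₀ ∘ Sum.inr, ?_⟩
  · rw [← rank_map_ringHom φ, ← submatrix_map, hG.map_encoding]
    exact hx (.inl l)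
  · obtain hP | hP := Nat.eq_zero_or_pos (Fintype.card P)
    · exact hP.le.trans (Nat.zero_le _)
    · rw [← rank_map_ringHom φ, Matrix.map_mul, map_maskedMatrix, hG.map_encoding]
      exact hx (.inr ⟨0, by omega⟩)

variable [DecidableEq V]

theorem Acyclic.card_le_mincut_of_solvableOver (hG : G.Acyclic) {C : Set (Connection V μ)}
    (h : G.SolvableOver K S C) {D : Finset V} (hD : S ∉ D) {U : Finset (Fin μ)}
    (hU : ∀ i ∈ U, ∃ d ∈ C, d.dest ∈ D ∧ i ∈ d.demand) : U.card ≤ G.mincut K S D := by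
  obtain ⟨p, hp⟩ := hG.solvableOver_iff.1 h
  refine (le_mincut_iff hD).2 fun Ω hS hdisj =>
    le_trans ?_ (hG.finrank_span_encoding_row_le p hS)
  have hind : LinearIndependent K fun i : U => (Pi.single i.1 1 : Fin μ → K) :=
    (Pi.linearIndependent_single_one (Fin μ) K).comp _ Subtype.val_injective
  rw [← Fintype.card_coe U, ← finrank_span_eq_card hind]
  refine Submodule.finrank_mono (Submodule.span_le.2 ?_)
  rintro _ ⟨i, rfl⟩
  obtain ⟨d, hd, hdD, hid⟩ := hU i i.2
  refine Submodule.span_mono (Set.image_mono fun b hb => ?_) (hp d hd i hid)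
  rw [Set.mem_ofPred, show G.inNode b = d.dest from hb]
  exact Finset.disjoint_left.1 hdisj hdD

theorem IsGeneric.exists_linearIndependent [Finite P] {p : (O × Fin μ) ⊕ (O × I) → K}
    (hp : G.IsGeneric S p) (hG : G.Acyclic) {T : P → V} (hT : ∀ t, T t ≠ S)
    (hP : Nat.card P ≤ μ) (hcut : ∀ J : Finset P, J.card ≤ G.mincut K S (J.image T)) :
    ∃ w : P → Fin μ → K, (∀ t, w t ∈ Submodule.span K ((G.encoding S p).row ''
      {b | G.inNode b = T t})) ∧ LinearIndependent K w := by
  have := Fintype.ofFinite P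
  refine exists_linearIndependent_mem_of_card_le_finrank_sup fun J => ?_
  refine (hp.le_finrank_span_encoding_row hG (D := J.image T) (by simpa using fun t _ => hT t)
    ?_ (hcut J)).trans (Submodule.finrank_mono (Submodule.span_le.2 ?_))
  · exact J.card_le_univ.trans (Nat.card_eq_fintype_card.symm.le.trans hP)
  · rintro _ ⟨b, hb, rfl⟩
    obtain ⟨t, ht, htb⟩ := Finset.mem_image.1 hb
    refine (Finset.le_sup (f := fun t => Submodule.span K ((G.encoding S p).row ''
      {b | G.inNode b = T t})) ht) (Submodule.subset_span ⟨b, htb.symm, rfl⟩)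

theorem Acyclic.exists_span_encoding_row_eq_top [Fintype P] [Fintype ι] (hG : G.Acyclic)
    {T : P → V} (hT : ∀ t, T t ≠ S) {T' : ι → V} (hT' : ∀ l, T' l ≠ S) (hP : Fintype.card P ≤ μ)
    (hcut : ∀ J : Finset P, J.card ≤ G.mincut K S (J.image T))
    (hcut' : ∀ l, μ ≤ G.mincut K S {T' l}) {s : Finset K}
    (hs : Fintype.card ι + min (Fintype.card P) 1 < s.card) :
    ∃ p : (O × Fin μ) ⊕ (O × I) → K,
      (∀ l, Submodule.span K ((G.encoding S p).row '' {b | G.inNode b = T' l}) = ⊤) ∧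
      ∃ w : P → Fin μ → K, (∀ t, w t ∈ Submodule.span K ((G.encoding S p).row ''
        {b | G.inNode b = T t})) ∧ LinearIndependent K w := by
  let φ := algebraMap K (AlgebraicClosure K)
  simp only [mincut_eq_of_ringHom φ] at hcut hcut'
  obtain ⟨p, hp⟩ := hG.exists_isGeneric (K := AlgebraicClosure K) S μ
  obtain ⟨ε, hε⟩ := exists_linearIndependent_mem_span_iff.1
    (hp.exists_linearIndependent hG hT (Nat.card_eq_fintype_card.trans_le hP) hcut)
  obtain ⟨p₀, hp₀, hε₀⟩ := hG.exists_le_rank_of_ringHom φ T T' (p := p) (fun l => by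
    rw [rank_submatrix_val_eq_finrank_span_image_row]
    exact (hp.le_finrank_span_encoding_row hG (by simpa using (hT' l).symm) le_rfl (hcut' l)).trans
      (Submodule.finrank_mono (Submodule.span_mono (Set.image_mono fun b hb =>
        Finset.mem_singleton.1 hb)))) hε hs
  refine ⟨p₀, fun l => Submodule.eq_top_of_finrank_eq (le_antisymm (Submodule.finrank_le _) ?_),
    exists_linearIndependent_mem_span_iff.2 hε₀⟩
  rw [finrank_fin_fun, ← rank_submatrix_val_eq_finrank_span_image_row]
  exact hp₀ l

theorem Acyclic.twoLevelCutConditions_of_solvableOver (hG : G.Acyclic) {k l : ℕ} {T : Fin k → V}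
    {T' : Fin l → V} (hT : ∀ t, T t ≠ S) (hT' : ∀ t, T' t ≠ S) {X : Fin k → Finset (Fin μ)}
    (hX : Pairwise fun t₁ t₂ => Disjoint (X t₁) (X t₂))
    (h : G.SolvableOver K S (twoLevelConnections T X T')) :
    TwoLevelCutConditions G K S T X T' := by
  constructor
  · intro J
    rw [← Finset.card_biUnion fun t₁ _ t₂ _ hne => hX hne]
    refine hG.card_le_mincut_of_solvableOver h (by simpa using fun t _ => hT t) fun i hi => ?_
    obtain ⟨t, ht, hit⟩ := Finset.mem_biUnion.1 hi
    exact ⟨_, .inl ⟨t, rfl⟩, Finset.mem_image_of_mem T ht, hit⟩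
  · intro t
    conv_lhs => rw [← Finset.card_fin μ]
    exact hG.card_le_mincut_of_solvableOver h (by simpa using (hT' t).symm) fun i hi =>
      ⟨_, .inr ⟨t, rfl⟩, Finset.mem_singleton_self _, hi⟩

theorem Acyclic.solvableOver_of_twoLevelCutConditions (hG : G.Acyclic) {k l : ℕ} {T : Fin k → V}
    {T' : Fin l → V} (hT : ∀ t, T t ≠ S) (hT' : ∀ t, T' t ≠ S) {X : Fin k → Finset (Fin μ)}
    (hX : Pairwise fun t₁ t₂ => Disjoint (X t₁) (X t₂)) {s : Finset K} (hs : l + min k 1 < s.card)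
    (h : TwoLevelCutConditions G K S T X T') :
    G.SolvableOver K S (twoLevelConnections T X T') := by
  have hinj : Function.Injective fun x : Σ t, X t => x.2.1 := by
    rintro ⟨t₁, i, hi₁⟩ ⟨t₂, _, hi₂⟩ rfl
    obtain rfl : t₁ = t₂ := by
      by_contra hne
      exact Finset.disjoint_left.1 (hX hne) hi₁ hi₂
    rfl
  have hcard : Fintype.card (Fin l) + min (Fintype.card (Σ t, X t)) 1 < s.card := by
    refine lt_of_le_of_lt ?_ hs
    obtain rfl | hk := Nat.eq_zero_or_pos k
    · simp
    · rw [Fintype.card_fin]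
      omega
  obtain ⟨p, htop, w, hw, hind⟩ := hG.exists_span_encoding_row_eq_top
    (T := fun x : Σ t, X t => T x.1) (fun x => hT x.1) hT'
    ((Fintype.card_le_of_injective _ hinj).trans (Fintype.card_fin μ).le)
    (card_le_mincut_of_twoLevelCutConditions h) h.2 hcard
  refine hG.solvableOver_of_linearIndependent (p := p) hind hinj ?_
  rintro _ (⟨t, rfl⟩ | ⟨t, rfl⟩) i hi
  · exact .inr ⟨⟨t, i, hi⟩, rfl, hw ⟨t, i, hi⟩⟩
  · exact .inl (htop t)

end TwoLevel
end ADTNetwork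

theorem mainTheorem7_general {V I O : Type*} [DecidableEq V] [Fintype I] [Fintype O]
    (F : Type u) [Field F] [Finite F] (G : ADTNetwork V I O) (hG : G.Acyclic) (S : V)
    (μ K L : ℕ) (T : Fin K → V) (T' : Fin L → V) (hT : ∀ k, T k ≠ S) (hT' : ∀ l, T' l ≠ S)
    (X : Fin K → Finset (Fin μ)) (hX : ∀ k₁ k₂, k₁ ≠ k₂ → Disjoint (X k₁) (X k₂)) :
    (G.Solvable F S (twoLevelConnections T X T') ↔ TwoLevelCutConditions G F S T X T') ∧
    (L + min K 1 < Nat.card F →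
      (G.SolvableOver F S (twoLevelConnections T X T') ↔ TwoLevelCutConditions G F S T X T')) := by
  have necessary : ∀ {K' : Type u} [Field K'],
      G.SolvableOver K' S (twoLevelConnections T X T') → TwoLevelCutConditions G K' S T X T' :=
    hG.twoLevelCutConditions_of_solvableOver hT hT' fun k₁ k₂ => hX k₁ k₂
  have sufficient : ∀ {K' : Type u} [Field K'] [Finite K'], L + min K 1 < Nat.card K' →
      TwoLevelCutConditions G K' S T X T' → G.SolvableOver K' S (twoLevelConnections T X T') := by
    intro K' _ _ hcard
    have := Fintype.ofFinite K'
    exact hG.solvableOver_of_twoLevelCutConditions hT hT' (fun k₁ k₂ => hX k₁ k₂)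
      (hcard.trans_eq Nat.card_eq_fintype_card)
  refine ⟨⟨?_, fun h => ?_⟩, fun hcard => ⟨necessary, sufficient hcard⟩⟩
  · rintro ⟨K', _, _, _, h⟩
    exact (ADTNetwork.twoLevelCutConditions_iff_of_ringHom (algebraMap F K')).2 (necessary h)
  · obtain ⟨K', _, _, _, hcard⟩ := exists_finite_field_extension_card_gt F (L + min K 1)
    exact ⟨K', inferInstance, inferInstance, inferInstance,
      sufficient hcard ((ADTNetwork.twoLevelCutConditions_iff_of_ringHom (algebraMap F K')).1 h)⟩

theorem mainTheorem7 {V I O : Type*} [Fintype V] [DecidableEq V] [Fintype I] [Fintype O]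
    (F : Type u) [Field F] [Fintype F] (G : ADTNetwork V I O) (hG : G.Acyclic) (S : V)
    (μ K L : ℕ) (T : Fin K → V) (T' : Fin L → V) (hT : ∀ k, T k ≠ S) (hT' : ∀ l, T' l ≠ S)
    (X : Fin K → Finset (Fin μ)) (hX : ∀ k₁ k₂, k₁ ≠ k₂ → Disjoint (X k₁) (X k₂)) :
    (G.Solvable F S (twoLevelConnections T X T') ↔ TwoLevelCutConditions G F S T X T') ∧
    (K + L < Fintype.card F →
      (G.SolvableOver F S (twoLevelConnections T X T') ↔
        TwoLevelCutConditions G F S T X T')) := by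
  obtain ⟨h, hq⟩ := mainTheorem7_general F G hG S μ K L T T' hT hT' X hX
  exact ⟨h, fun hcard => hq (by rw [Nat.card_eq_fintype_card]; omega)⟩
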